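/- Let $n\ge 1$ and $0<q<1$, and let $\sigma$ be a nonnegative locally finite Borel measure on the open upper half-space $\mathbb{R}^{n+1}_+=\{(x,y): x\in\mathbb{R}^n,\ y>0\}$. Let $$P(x,y)=\frac{\Gamma\left(\frac{n+1}{2}\right)}{\pi^{\frac{n+1}{2}}}\,\frac{y}{(|x|^2+y^2)^{\frac{n+1}{2}}},\qquad x\in\mathbb{R}^n,\ y>0,$$ be the Poisson kernel. For nonnegative locally finite Borel measures $\nu$ on $\mathbb{R}^n$ and $\mu$ on $\mathbb{R}^{n+1}_+$ put $$\mathbf{P}\nu(x,y)=\int_{\mathbb{R}^n}P(x-t,y)\,d\nu(t),\qquad \mathbf{P}^*\mu(t)=\int_{\mathbb{R}^{n+1}_+}P(x-t,y)\,d\mu(x,y),$$ with values in $[0,+\infty]$, and write $\mathbf{P}\phi=\mathbf{P}(\phi\,dt)$ for a nonnegative function $\phi$ on $\mathbb{R}^n$. Functions in $L^1(\mathbb{R}^n)$ are taken with respect to Lebesgue measure and may take the value $+\infty$ on a null set. Then there is a constant $\varkappa>0$ with $$\|\mathbf{P}\nu\|_{L^q(\mathbb{R}^{n+1}_+,\sigma)}\le\varkappa\,\nu(\mathbb{R}^n)\quad\text{for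 all nonnegative locally finite Borel measures }\nu\text{ on }\mathbb{R}^n \tag{1}$$ if and only if there is a function $\phi\in L^1(\mathbb{R}^n)$ with $\phi>0$ a.e. such that $$\phi\ge\mathbf{P}^*\big[(\mathbf{P}\phi)^q\,d\sigma\big]\quad\text{a.e. in }\mathbb{R}^n.$$ Moreover, if (1) holds and $\sigma\ne 0$, then there is an everywhere positive $\phi\in L^1(\mathbb{R}^n)$ such that $\phi=\mathbf{P}^*\big[(\mathbf{P}\phi)^q\,d\sigma\big]$ everywhere in $\mathbb{R}^n$. -/

import Mathlib

open MeasureTheory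
open scoped ENNReal

/-- The open upper half-space `ℝ^{n+1}_+ = {(x, y) : x ∈ ℝ^n, y > 0}`, with its usual topology and
Borel sets.  Locally finite measures on it are the measures finite on its compact subsets. -/
abbrev UpperHalfSpace (n : ℕ) : Type :=
  EuclideanSpace ℝ (Fin n) × Set.Ioi (0 : ℝ)

/-- The Poisson kernel of `ℝ^{n+1}_+`,
`P(x, y) = Γ((n+1)/2) π^{-(n+1)/2} · y / (|x|² + y²)^{(n+1)/2}`. -/
noncomputable def poissonKernelHS (n : ℕ) (x : EuclideanSpace ℝ (Fin n)) (y : ℝ) : ℝ :=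
  Real.Gamma (((n : ℝ) + 1) / 2) / Real.pi ^ (((n : ℝ) + 1) / 2) *
    (y / (‖x‖ ^ 2 + y ^ 2) ^ (((n : ℝ) + 1) / 2))

/-- The Poisson integral `Pν(x, y) = ∫ P(x - t, y) dν(t)`, with values in `[0, ∞]`. -/
noncomputable def poissonIntegral {n : ℕ} (ν : Measure (EuclideanSpace ℝ (Fin n)))
    (z : UpperHalfSpace n) : ℝ≥0∞ :=
  ∫⁻ t, ENNReal.ofReal (poissonKernelHS n (z.1 - t) z.2) ∂ν

/-- The balayage `P*μ(t) = ∫ P(x - t, y) dμ(x, y)`, with values in `[0, ∞]`. -/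
noncomputable def poissonBalayage {n : ℕ} (μ : Measure (UpperHalfSpace n))
    (t : EuclideanSpace ℝ (Fin n)) : ℝ≥0∞ :=
  ∫⁻ z, ENNReal.ofReal (poissonKernelHS n (z.1 - t) z.2) ∂μ

/-- `Pφ = P(φ dt)` for a nonnegative function `φ`, where `dt` is Lebesgue measure. -/
noncomputable def poissonIntegralFun {n : ℕ} (φ : EuclideanSpace ℝ (Fin n) → ℝ≥0∞) :
    UpperHalfSpace n → ℝ≥0∞ :=
  poissonIntegral ((volume : Measure (EuclideanSpace ℝ (Fin n))).withDensity φ)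

/-- `P*[(Pφ)^q dσ]`. -/
noncomputable def poissonNonlinear {n : ℕ} (q : ℝ) (σ : Measure (UpperHalfSpace n))
    (φ : EuclideanSpace ℝ (Fin n) → ℝ≥0∞) : EuclideanSpace ℝ (Fin n) → ℝ≥0∞ :=
  poissonBalayage (σ.withDensity fun z => poissonIntegralFun φ z ^ q)

/-- The `(1, q)`-Carleson inequality: for some constant `ϰ > 0`,
`‖Pν‖_{L^q(σ)} ≤ ϰ ν(ℝ^n)` for all locally finite Borel measures `ν` on `ℝ^n`. -/
def PoissonCarleson {n : ℕ} (q : ℝ) (σ : Measure (UpperHalfSpace n)) : Prop :=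
  ∃ ϰ : ℝ, 0 < ϰ ∧
    ∀ ν : Measure (EuclideanSpace ℝ (Fin n)), IsLocallyFiniteMeasure ν →
      eLpNorm (poissonIntegral ν) (ENNReal.ofReal q) σ ≤ ENNReal.ofReal ϰ * ν Set.univ

open Set Metric Filter Topology

/-! ### Scaling, mass and positivity of the Poisson kernel. -/

section Kernel

variable {n : ℕ}

/-! Write `T φ = P*[(Pφ)^q dσ]`.

Suppose `T φ ≤ φ`. Put `u = Pφ` and `ω = u^q σ`, so that `P*ω ≤ φ`. Integration over ℝⁿ shows that
`ω` is finite. For a probability measure `ν`, the integral of `(Pν)^q` against `σ` is that of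
`(Pν/u)^q` against `ω`; since `q < 1` and `ω` is finite, a weak-type (1,1) bound for `Pν/u`
suffices, and homogeneity removes the normalization of `ν`. The weak-type bound,
`exists_measure_mul_lt_poissonIntegral_le`, combines three facts: `P*ω ≤ φ` controls `ω` on balls by
`φ dt` on tripled boundary balls; domination on all balls of radius at least the height passes to
Poisson integrals; and a Besicovitch covering sums the balls on which domination fails.

Conversely, under (1) the monotone map `T` satisfies `‖T φ‖₁ ≤ A ‖φ‖₁^q`, which is sublinear.
Iterating from a small subsolution gives an increasing sequence bounded in `L¹`; by monotone
convergence its supremum is a fixed point. -/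

lemma poissonKernelHS_const_pos (n : ℕ) :
    0 < Real.Gamma (((n : ℝ) + 1) / 2) / Real.pi ^ (((n : ℝ) + 1) / 2) :=
  div_pos (Real.Gamma_pos_of_pos (by positivity)) (Real.rpow_pos_of_pos Real.pi_pos _)

lemma poissonKernelHS_pos (x : EuclideanSpace ℝ (Fin n)) {y : ℝ} (hy : 0 < y) :
    0 < poissonKernelHS n x y := by
  have := poissonKernelHS_const_pos n
  unfold poissonKernelHS
  positivity

lemma poissonKernelHS_anti {x x' : EuclideanSpace ℝ (Fin n)} {y : ℝ} (hy : 0 < y)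
    (h : ‖x‖ ≤ ‖x'‖) : poissonKernelHS n x' y ≤ poissonKernelHS n x y := by
  have := poissonKernelHS_const_pos n
  unfold poissonKernelHS
  gcongr

lemma poissonKernelHS_dilation (s : EuclideanSpace ℝ (Fin n)) {y : ℝ} (hy : 0 < y) :
    y ^ n * poissonKernelHS n (y • s) y = poissonKernelHS n s 1 := by
  unfold poissonKernelHS
  have h1 : ‖y • s‖ ^ 2 + y ^ 2 = y ^ 2 * (‖s‖ ^ 2 + 1 ^ 2) := by
    rw [norm_smul, Real.norm_of_nonneg hy.le]; ring
  have h2 : (y ^ 2) ^ (((n : ℝ) + 1) / 2) = y ^ (n + 1) := by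
    rw [← Real.rpow_natCast y 2, ← Real.rpow_mul hy.le, ← Real.rpow_natCast y (n + 1)]
    congr 1; push_cast; ring
  rw [h1, Real.mul_rpow (by positivity) (by positivity), h2]
  have h3 : (‖s‖ ^ 2 + 1 ^ 2) ^ (((n : ℝ) + 1) / 2) ≠ 0 := by positivity
  field_simp
  ring

lemma continuous_poissonKernelHS :
    Continuous fun p : UpperHalfSpace n × EuclideanSpace ℝ (Fin n) =>
      poissonKernelHS n (p.1.1 - p.2) p.1.2 := by
  unfold poissonKernelHS
  refine continuous_const.mul (Continuous.div (by fun_prop) ?_ ?_)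
  · refine Continuous.rpow_const (by fun_prop) fun p => Or.inr (by positivity)
  · intro p
    have : (0 : ℝ) < p.1.2 := p.1.2.2
    positivity

lemma measurable_poissonKernelHS :
    Measurable fun p : UpperHalfSpace n × EuclideanSpace ℝ (Fin n) =>
      ENNReal.ofReal (poissonKernelHS n (p.1.1 - p.2) p.1.2) :=
  continuous_poissonKernelHS.measurable.ennreal_ofReal

lemma measurable_poissonKernelHS_right (z : UpperHalfSpace n) :
    Measurable fun t : EuclideanSpace ℝ (Fin n) =>
      ENNReal.ofReal (poissonKernelHS n (z.1 - t) z.2) :=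
  measurable_poissonKernelHS.comp (measurable_const.prodMk measurable_id)

lemma measurable_poissonKernelHS_left (t : EuclideanSpace ℝ (Fin n)) :
    Measurable fun z : UpperHalfSpace n =>
      ENNReal.ofReal (poissonKernelHS n (z.1 - t) z.2) :=
  measurable_poissonKernelHS.comp (measurable_id.prodMk measurable_const)

lemma measurable_poissonIntegral (ν : Measure (EuclideanSpace ℝ (Fin n))) [SFinite ν] :
    Measurable (poissonIntegral ν) :=
  measurable_poissonKernelHS.lintegral_prod_right'

lemma measurable_poissonBalayage (μ : Measure (UpperHalfSpace n)) [SFinite μ] :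
    Measurable (poissonBalayage μ) :=
  measurable_poissonKernelHS.lintegral_prod_left'

lemma poissonIntegralFun_eq {φ : EuclideanSpace ℝ (Fin n) → ℝ≥0∞} (hφ : AEMeasurable φ)
    (z : UpperHalfSpace n) :
    poissonIntegralFun φ z =
      ∫⁻ t, φ t * ENNReal.ofReal (poissonKernelHS n (z.1 - t) z.2) := by
  unfold poissonIntegralFun poissonIntegral
  rw [lintegral_withDensity_eq_lintegral_mul₀ hφ
    (measurable_poissonKernelHS_right z).aemeasurable]
  rfl

lemma measurable_poissonIntegralFun (φ : EuclideanSpace ℝ (Fin n) → ℝ≥0∞) :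
    Measurable (poissonIntegralFun φ) :=
  measurable_poissonIntegral _

lemma poissonNonlinear_eq (q : ℝ) (σ : Measure (UpperHalfSpace n))
    (φ : EuclideanSpace ℝ (Fin n) → ℝ≥0∞) (t : EuclideanSpace ℝ (Fin n)) :
    poissonNonlinear q σ φ t =
      ∫⁻ z, poissonIntegralFun φ z ^ q * ENNReal.ofReal (poissonKernelHS n (z.1 - t) z.2) ∂σ := by
  unfold poissonNonlinear poissonBalayage
  rw [lintegral_withDensity_eq_lintegral_mul _ ((measurable_poissonIntegralFun φ).pow_const q)
    (measurable_poissonKernelHS_left t)]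
  rfl

lemma measurable_poissonNonlinear (q : ℝ) (σ : Measure (UpperHalfSpace n)) [SFinite σ]
    (φ : EuclideanSpace ℝ (Fin n) → ℝ≥0∞) : Measurable (poissonNonlinear q σ φ) :=
  measurable_poissonBalayage _

lemma lintegral_poissonBalayage (μ : Measure (UpperHalfSpace n)) [SFinite μ]
    (s : Set (EuclideanSpace ℝ (Fin n))) :
    ∫⁻ t in s, poissonBalayage μ t =
      ∫⁻ z, (∫⁻ t in s, ENNReal.ofReal (poissonKernelHS n (z.1 - t) z.2)) ∂μ :=
  lintegral_lintegral_swap (measurable_poissonKernelHS.comp measurable_swap).aemeasurable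

/-- Translation and dilation invariance; only the finiteness of the common mass is needed, not its
value. -/
lemma lintegral_poissonKernelHS_eq (z : UpperHalfSpace n) :
    ∫⁻ t, ENNReal.ofReal (poissonKernelHS n (z.1 - t) z.2) =
      ∫⁻ s, ENNReal.ofReal (poissonKernelHS n s 1) := by
  have hy : (0 : ℝ) < z.2 := z.2.2
  rw [lintegral_sub_left_eq_self (fun s => ENNReal.ofReal (poissonKernelHS n s z.2)) z.1]
  have hm : Measurable fun s : EuclideanSpace ℝ (Fin n) =>
      ENNReal.ofReal (poissonKernelHS n s z.2) := by
    have := measurable_poissonKernelHS_right ((0 : EuclideanSpace ℝ (Fin n)), z.2)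
    simpa [Function.comp_def] using this.comp measurable_neg
  have h := lintegral_map (μ := volume) hm (measurable_const_smul (z.2 : ℝ))
  rw [Measure.map_addHaar_smul _ hy.ne', lintegral_smul_measure, finrank_euclideanSpace_fin,
    abs_of_pos (by positivity), ENNReal.ofReal_inv_of_pos (by positivity), smul_eq_mul] at h
  have h0 : ENNReal.ofReal ((z.2 : ℝ) ^ n) ≠ 0 := by
    rw [Ne, ENNReal.ofReal_eq_zero, not_le]; positivity
  calc _ = ENNReal.ofReal ((z.2 : ℝ) ^ n) * ((ENNReal.ofReal ((z.2 : ℝ) ^ n))⁻¹ *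
        ∫⁻ s, ENNReal.ofReal (poissonKernelHS n s z.2)) := by
        rw [← mul_assoc, ENNReal.mul_inv_cancel h0 ENNReal.ofReal_ne_top, one_mul]
    _ = _ := by
      rw [h, ← lintegral_const_mul' _ _ ENNReal.ofReal_ne_top]
      congr with s
      rw [← ENNReal.ofReal_mul (by positivity), poissonKernelHS_dilation s hy]

lemma lintegral_poissonKernelHS_one_lt_top :
    ∫⁻ s, ENNReal.ofReal (poissonKernelHS n s 1) < ∞ := by
  have h : Integrable fun s : EuclideanSpace ℝ (Fin n) => poissonKernelHS n s 1 := by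
    refine ((integrable_rpow_neg_one_add_norm_sq (E := EuclideanSpace ℝ (Fin n)) (μ := volume)
      (r := (n : ℝ) + 1) (by simp)).const_mul
        (Real.Gamma (((n : ℝ) + 1) / 2) / Real.pi ^ (((n : ℝ) + 1) / 2))).congr
        (Eventually.of_forall fun s => ?_)
    simp only [poissonKernelHS]
    rw [neg_div, Real.rpow_neg (by positivity), one_pow, add_comm (1 : ℝ), one_div]
  exact h.lintegral_lt_top

/-- At distance less than `y` from its centre the kernel is at least a constant times `y⁻ⁿ`, while
the ball has volume proportional to `yⁿ`. -/
lemma exists_le_lintegral_ball_poissonKernelHS (n : ℕ) :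
    ∃ c : ℝ≥0∞, c ≠ 0 ∧ c ≠ ∞ ∧ ∀ z : UpperHalfSpace n,
      c ≤ ∫⁻ t in ball z.1 z.2, ENNReal.ofReal (poissonKernelHS n (z.1 - t) z.2) := by
  have hC := poissonKernelHS_const_pos n
  set C := Real.Gamma (((n : ℝ) + 1) / 2) / Real.pi ^ (((n : ℝ) + 1) / 2) with hCdef
  refine ⟨ENNReal.ofReal (C * (1 / 2 ^ (((n : ℝ) + 1) / 2))) *
    volume (ball (0 : EuclideanSpace ℝ (Fin n)) 1), ?_, ?_, fun z => ?_⟩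
  · refine mul_ne_zero ?_ (measure_ball_pos _ _ one_pos).ne'
    rw [Ne, ENNReal.ofReal_eq_zero, not_le]
    positivity
  · exact ENNReal.mul_ne_top ENNReal.ofReal_ne_top measure_ball_lt_top.ne
  have hy : (0 : ℝ) < z.2 := z.2.2
  have key : ∀ t ∈ ball z.1 (z.2 : ℝ),
      ENNReal.ofReal (C * (1 / 2 ^ (((n : ℝ) + 1) / 2)) / (z.2 : ℝ) ^ n) ≤
        ENNReal.ofReal (poissonKernelHS n (z.1 - t) z.2) := by
    intro t ht
    apply ENNReal.ofReal_le_ofReal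
    rw [mem_ball, dist_comm, dist_eq_norm] at ht
    unfold poissonKernelHS
    rw [← hCdef, mul_div_assoc]
    refine mul_le_mul_of_nonneg_left ?_ hC.le
    have h2 : ((z.2 : ℝ) ^ 2) ^ (((n : ℝ) + 1) / 2) = (z.2 : ℝ) ^ (n + 1) := by
      rw [← Real.rpow_natCast (z.2 : ℝ) 2, ← Real.rpow_mul hy.le,
        ← Real.rpow_natCast (z.2 : ℝ) (n + 1)]
      congr 1; push_cast; ring
    calc (1 : ℝ) / 2 ^ (((n : ℝ) + 1) / 2) / (z.2 : ℝ) ^ n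
        = z.2 / (2 * (z.2 : ℝ) ^ 2) ^ (((n : ℝ) + 1) / 2) := by
          rw [Real.mul_rpow (by positivity) (by positivity), h2]
          field_simp
          ring
      _ ≤ z.2 / (‖z.1 - t‖ ^ 2 + (z.2 : ℝ) ^ 2) ^ (((n : ℝ) + 1) / 2) := by
          have : ‖z.1 - t‖ ^ 2 ≤ (z.2 : ℝ) ^ 2 := by gcongr
          gcongr
          linarith
  calc _ = ∫⁻ t in ball z.1 (z.2 : ℝ),
        ENNReal.ofReal (C * (1 / 2 ^ (((n : ℝ) + 1) / 2)) / (z.2 : ℝ) ^ n) := by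
        rw [setLIntegral_const, Measure.addHaar_ball_of_pos _ _ hy, finrank_euclideanSpace_fin,
          ← mul_assoc, ← ENNReal.ofReal_mul (by positivity)]
        congr 2
        field_simp
    _ ≤ _ := setLIntegral_mono (measurable_poissonKernelHS_right z) key

lemma poissonIntegral_pos {ν : Measure (EuclideanSpace ℝ (Fin n))} (hν : ν ≠ 0)
    (z : UpperHalfSpace n) : 0 < poissonIntegral ν z := by
  unfold poissonIntegral
  rw [lintegral_pos_iff_support (measurable_poissonKernelHS_right z)]
  have : (Function.support fun t : EuclideanSpace ℝ (Fin n) =>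
      ENNReal.ofReal (poissonKernelHS n (z.1 - t) z.2)) = univ := by
    ext t
    simpa using poissonKernelHS_pos (z.1 - t) z.2.2
  rw [this]
  exact Measure.measure_univ_pos.2 hν

lemma poissonBalayage_pos {μ : Measure (UpperHalfSpace n)} (hμ : μ ≠ 0)
    (t : EuclideanSpace ℝ (Fin n)) : 0 < poissonBalayage μ t := by
  unfold poissonBalayage
  rw [lintegral_pos_iff_support (measurable_poissonKernelHS_left t)]
  have : (Function.support fun z : UpperHalfSpace n =>
      ENNReal.ofReal (poissonKernelHS n (z.1 - t) z.2)) = univ := by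
    ext z
    simpa using poissonKernelHS_pos (z.1 - t) z.2.2
  rw [this]
  exact Measure.measure_univ_pos.2 hμ

lemma poissonIntegral_lt_top (ν : Measure (EuclideanSpace ℝ (Fin n))) [IsFiniteMeasure ν]
    (z : UpperHalfSpace n) : poissonIntegral ν z < ∞ := by
  calc poissonIntegral ν z ≤ ∫⁻ _, ENNReal.ofReal (poissonKernelHS n 0 z.2) ∂ν :=
        lintegral_mono fun t => ENNReal.ofReal_le_ofReal
          (poissonKernelHS_anti z.2.2 (by simp))
    _ < ∞ := by
        rw [lintegral_const]
        exact ENNReal.mul_lt_top ENNReal.ofReal_lt_top (measure_lt_top _ _)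

end Kernel

/-! ### Ball comparison for Poisson integrals and a boundary covering estimate. -/

section WeakType

variable {n : ℕ}

lemma lt_poissonKernelHS_iff (v : EuclideanSpace ℝ (Fin n)) {y s : ℝ} (hy : 0 < y) (hs : 0 < s) :
    s < poissonKernelHS n v y ↔ ‖v‖ ^ 2 + y ^ 2 <
      (Real.Gamma (((n : ℝ) + 1) / 2) / Real.pi ^ (((n : ℝ) + 1) / 2) * y / s) ^
        (((n : ℝ) + 1) / 2)⁻¹ := by
  have hC := poissonKernelHS_const_pos n
  rw [Real.lt_rpow_inv_iff_of_pos (by positivity) (by positivity) (by positivity),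
    lt_div_iff₀ hs]
  unfold poissonKernelHS
  rw [← mul_div_assoc, lt_div_iff₀ (by positivity), mul_comm s]

lemma poissonKernelHS_third_le (v : EuclideanSpace ℝ (Fin n)) {y : ℝ} (hy : 0 < y) :
    poissonKernelHS n ((1 / 3 : ℝ) • v) y ≤
      9 ^ (((n : ℝ) + 1) / 2) * poissonKernelHS n v y := by
  have hC := poissonKernelHS_const_pos n
  unfold poissonKernelHS
  rw [mul_left_comm]
  refine mul_le_mul_of_nonneg_left ?_ hC.le
  rw [← mul_div_assoc, div_le_div_iff₀ (by positivity) (by positivity), mul_right_comm,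
    mul_comm y]
  refine mul_le_mul_of_nonneg_right ?_ hy.le
  rw [← Real.mul_rpow (by positivity) (by positivity)]
  refine Real.rpow_le_rpow (by positivity) ?_ (by positivity)
  rw [norm_smul, Real.norm_of_nonneg (by norm_num)]
  nlinarith [sq_nonneg y]

/-- A bound of the measures of all balls of radius at least the height passes to the Poisson
integrals. -/
lemma exists_poissonIntegral_le_of_ball_le (n : ℕ) :
    ∃ C : ℝ≥0∞, C ≠ 0 ∧ C ≠ ∞ ∧ ∀ (ν m : Measure (EuclideanSpace ℝ (Fin n))) (A : ℝ≥0∞)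
      (z : UpperHalfSpace n),
      (∀ r : ℝ, (z.2 : ℝ) ≤ r → ν (ball z.1 r) ≤ A * m (ball z.1 (3 * r))) →
        poissonIntegral ν z ≤ C * A * poissonIntegral m z := by
  set a : ℝ := ((n : ℝ) + 1) / 2 with ha
  have ha0 : 0 < a := by positivity
  have hC := poissonKernelHS_const_pos n
  set K := Real.Gamma (((n : ℝ) + 1) / 2) / Real.pi ^ (((n : ℝ) + 1) / 2) with hK
  refine ⟨ENNReal.ofReal (2 ^ a) * ENNReal.ofReal (9 ^ a),
    mul_ne_zero (by simp; positivity) (by simp; positivity), by finiteness,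
    fun ν m A z h => ?_⟩
  obtain ⟨x, ⟨y, hy⟩⟩ := z
  replace hy : 0 < y := hy
  simp only at h
  -- `D` is the kernel's value at distance `y`. Truncation at `D` leaves only superlevel sets that
  -- are empty or balls of radius at least `y`, and costs a factor `2 ^ a`, since the maximum of the
  -- kernel is `2 ^ a * D`.
  set D : ℝ := K * (y / (2 * y ^ 2) ^ a) with hD
  have hD0 : 0 < D := by positivity
  have hcont : Continuous fun t : EuclideanSpace ℝ (Fin n) => poissonKernelHS n (x - t) y :=
    continuous_poissonKernelHS.comp (f := fun t => (((x, ⟨y, hy⟩) : UpperHalfSpace n), t))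
      (by fun_prop)
  have hcont' : Continuous fun t : EuclideanSpace ℝ (Fin n) =>
      poissonKernelHS n ((1 / 3 : ℝ) • (x - t)) y := by
    simpa [Function.comp_def] using hcont.comp (g := fun t => poissonKernelHS n (x - t) y)
      (f := fun t => x - (1 / 3 : ℝ) • (x - t)) (by fun_prop)
  set f : EuclideanSpace ℝ (Fin n) → ℝ := fun t => min (poissonKernelHS n (x - t) y) D with hf
  -- Dilating the kernel by 3 triples the radii of its superlevel balls, which matches the
  -- hypothesis on `m`.
  set g : EuclideanSpace ℝ (Fin n) → ℝ :=
    fun t => min (poissonKernelHS n ((1 / 3 : ℝ) • (x - t)) y) D with hg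
  have hf0 : ∀ t, 0 ≤ f t := fun t => le_min (poissonKernelHS_pos _ hy).le hD0.le
  have hg0 : ∀ t, 0 ≤ g t := fun t => le_min (poissonKernelHS_pos _ hy).le hD0.le
  have hfc : Continuous f := hcont.min continuous_const
  have hgc : Continuous g := hcont'.min continuous_const
  have hPf : ∀ t, poissonKernelHS n (x - t) y ≤ 2 ^ a * f t := by
    intro t
    have h1 : (1 : ℝ) ≤ 2 ^ a := Real.one_le_rpow (by norm_num) ha0.le
    rw [hf, mul_min_of_nonneg _ _ (by positivity)]
    refine le_min (le_mul_of_one_le_left (poissonKernelHS_pos _ hy).le h1) ?_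
    refine (poissonKernelHS_anti hy (x := 0) (by simp)).trans (le_of_eq ?_)
    simp only [poissonKernelHS]
    rw [← hK, ← ha, hD, Real.mul_rpow (by positivity) (by positivity)]
    simp only [norm_zero, ne_eq, OfNat.ofNat_ne_zero, not_false_eq_true, zero_pow, zero_add]
    field_simp
  have hgP : ∀ t, g t ≤ 9 ^ a * poissonKernelHS n (x - t) y := fun t =>
    (min_le_left _ _).trans (poissonKernelHS_third_le _ hy)
  have hlevel : ∀ s : ℝ, 0 < s → ν {t | s < f t} ≤ A * m {t | s < g t} := by
    intro s hs
    rcases le_or_gt D s with hDs | hDs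
    · have : {t | s < f t} = ∅ := by
        ext t
        simp only [hf, mem_ofPred_eq, mem_empty_iff_false, iff_false, not_lt]
        exact (min_le_right _ _).trans hDs
      simp [this]
    · set B := (K * y / s) ^ a⁻¹ with hB
      have hBy : 2 * y ^ 2 < B := by
        rw [hB, Real.lt_rpow_inv_iff_of_pos (by positivity) (by positivity) ha0, lt_div_iff₀ hs,
          mul_comm, ← lt_div_iff₀ (by positivity)]
        rwa [hD, ← mul_div_assoc] at hDs
      have hmem : ∀ v : EuclideanSpace ℝ (Fin n),
          s < poissonKernelHS n v y ↔ ‖v‖ < √(B - y ^ 2) := by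
        intro v
        rw [lt_poissonKernelHS_iff v hy hs, Real.lt_sqrt (norm_nonneg v), lt_sub_iff_add_lt]
      have h1 : {t | s < f t} = ball x √(B - y ^ 2) := by
        ext t
        simp only [hf, mem_ofPred_eq, lt_min_iff, hDs, and_true, hmem, mem_ball, dist_comm t,
          dist_eq_norm]
      have h2 : {t | s < g t} = ball x (3 * √(B - y ^ 2)) := by
        ext t
        simp only [hg, mem_ofPred_eq, lt_min_iff, hDs, and_true, hmem, mem_ball, dist_comm t,
          dist_eq_norm, norm_smul]
        rw [Real.norm_of_nonneg (by norm_num : (0 : ℝ) ≤ 1 / 3)]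
        constructor <;> intro h <;> linarith
      rw [h1, h2]
      refine h _ (Real.le_sqrt_of_sq_le ?_)
      linarith
  calc poissonIntegral ν (x, ⟨y, hy⟩)
      ≤ ∫⁻ t, ENNReal.ofReal (2 ^ a) * ENNReal.ofReal (f t) ∂ν := by
        refine lintegral_mono fun t => ?_
        rw [← ENNReal.ofReal_mul (by positivity)]
        exact ENNReal.ofReal_le_ofReal (hPf t)
    _ = ENNReal.ofReal (2 ^ a) * ∫⁻ s in Ioi (0 : ℝ), ν {t | s < f t} := by
        rw [lintegral_const_mul' _ _ ENNReal.ofReal_ne_top,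
          lintegral_eq_lintegral_meas_lt ν (Eventually.of_forall hf0) hfc.measurable.aemeasurable]
    _ ≤ ENNReal.ofReal (2 ^ a) * ∫⁻ s in Ioi (0 : ℝ), A * m {t | s < g t} := by
        refine mul_le_mul_right ?_ _
        exact setLIntegral_mono' measurableSet_Ioi fun s hs => hlevel s hs
    _ = ENNReal.ofReal (2 ^ a) * (A * ∫⁻ t, ENNReal.ofReal (g t) ∂m) := by
        rw [lintegral_const_mul, lintegral_eq_lintegral_meas_lt m (Eventually.of_forall hg0)
          hgc.measurable.aemeasurable]
        exact Antitone.measurable fun s s' hss => measure_mono fun t ht => lt_of_le_of_lt hss ht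
    _ ≤ ENNReal.ofReal (2 ^ a) * (A * (ENNReal.ofReal (9 ^ a) *
          poissonIntegral m (x, ⟨y, hy⟩))) := by
        gcongr
        unfold poissonIntegral
        rw [← lintegral_const_mul' _ _ ENNReal.ofReal_ne_top]
        refine lintegral_mono fun t => ?_
        rw [← ENNReal.ofReal_mul (by positivity)]
        exact ENNReal.ofReal_le_ofReal (hgP t)
    _ = _ := by ring

/-- A Besicovitch-type covering estimate in the half-space, for balls that reach its boundary. -/
lemma exists_measure_le_of_closedBall_le (n : ℕ) :
    ∃ N : ℕ, ∀ (ω : Measure (UpperHalfSpace n)) (ν : Measure (EuclideanSpace ℝ (Fin n)))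
      (B : ℝ≥0∞) (S : Set (UpperHalfSpace n)),
      (∀ z ∈ S, ∃ r : ℝ, (z.2 : ℝ) ≤ r ∧ ω (closedBall z r) ≤ B * ν (ball z.1 r)) →
        ω S ≤ N * (B * ν univ) := by
  obtain ⟨N, τ, hτ, hN⟩ := HasBesicovitchCovering.no_satelliteConfig
    (α := EuclideanSpace ℝ (Fin n) × ℝ)
  refine ⟨N, fun ω ν B S h => ?_⟩
  choose! r hry hr using h
  -- The covering theorem needs bounded radii; `N` does not depend on the bound `k`.
  have hS : S = ⋃ k : ℕ, {z ∈ S | r z ≤ k} := by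
    ext z
    simp only [mem_iUnion, mem_ofPred_eq, exists_and_left]
    exact ⟨fun hz => ⟨hz, exists_nat_ge _⟩, fun hz => hz.1⟩
  have hmono : Monotone fun k : ℕ => {z ∈ S | r z ≤ k} := by
    intro k l hkl z hz
    exact ⟨hz.1, hz.2.trans (by exact_mod_cast hkl)⟩
  rw [hS, hmono.measure_iUnion]
  refine iSup_le fun k => ?_
  set T := {z ∈ S | r z ≤ k}
  let b : Besicovitch.BallPackage T (EuclideanSpace ℝ (Fin n) × ℝ) :=
    { c := fun z => (z.1.1, (z.1.2 : ℝ))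
      r := fun z => r z.1
      rpos := fun z => lt_of_lt_of_le z.1.2.2 (hry z.1 z.2.1)
      r_bound := k
      r_le := fun z => z.2.2 }
  obtain ⟨s, hsd, hsc⟩ := Besicovitch.exist_disjoint_covering_families hτ hN b
  have hcount : ∀ i, (s i).Countable := fun i =>
    (hsd i).countable_of_nonempty_interior fun j _ =>
      (nonempty_ball.2 (b.rpos j)).mono ball_subset_interior_closedBall
  have hdisj : ∀ i, (s i).PairwiseDisjoint fun j : T => ball j.1.1 (r j.1) := by
    intro i j hj l hl hjl
    refine Set.disjoint_left.2 fun t htj htl => ?_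
    -- In the sup metric, a ball whose radius is at least the height of its centre contains its own
    -- projection to the boundary. Disjoint balls therefore have disjoint projections.
    have hin : ∀ j : T, t ∈ ball j.1.1 (r j.1) → (t, (0 : ℝ)) ∈ closedBall (b.c j) (b.r j) := by
      intro j ht
      rw [mem_closedBall, Prod.dist_eq]
      refine max_le (mem_ball.1 ht).le ?_
      have : (0 : ℝ) < j.1.2 := j.1.2.2
      simpa [b, Real.dist_eq, abs_of_pos this] using hry j.1 j.2.1
    exact Set.disjoint_left.1 (hsd i hj hl hjl) (hin j htj) (hin l htl)
  have hcover : T ⊆ ⋃ i, ⋃ j ∈ s i, closedBall j.1 (r j.1) := by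
    intro z hz
    have := hsc (mem_range_self (⟨z, hz⟩ : T))
    simp only [mem_iUnion] at this ⊢
    obtain ⟨i, j, hj, hzj⟩ := this
    exact ⟨i, j, hj, (mem_ball.1 hzj).le⟩
  calc ω T ≤ ω (⋃ i, ⋃ j ∈ s i, closedBall j.1 (r j.1)) := measure_mono hcover
    _ ≤ ∑ i, ω (⋃ j ∈ s i, closedBall j.1 (r j.1)) := by
        simpa using measure_iUnion_le (μ := ω) fun i => ⋃ j ∈ s i, closedBall j.1 (r j.1)
    _ ≤ ∑ _i : Fin N, B * ν univ := by
        refine Finset.sum_le_sum fun i _ => ?_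
        calc _ ≤ ∑' j : s i, ω (closedBall j.1.1 (r j.1.1)) :=
              measure_biUnion_le ω (hcount i) _
          _ ≤ ∑' j : s i, B * ν (ball j.1.1.1 (r j.1.1)) :=
              ENNReal.tsum_le_tsum fun j => hr _ j.1.2.1
          _ = B * ν (⋃ j ∈ s i, ball j.1.1 (r j.1)) := by
              rw [ENNReal.tsum_mul_left,
                measure_biUnion (hcount i) (hdisj i) fun _ _ => measurableSet_ball]
          _ ≤ B * ν univ := by gcongr; exact subset_univ _
    _ = _ := by simp

end WeakType

/-! ### From a supersolution to the Carleson inequality. -/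

section Sufficiency

variable {n : ℕ}

lemma poissonCarleson_iff {q : ℝ} (hq0 : 0 < q) (σ : Measure (UpperHalfSpace n)) :
    PoissonCarleson q σ ↔ ∃ M : ℝ≥0∞, M ≠ ∞ ∧ ∀ ν : Measure (EuclideanSpace ℝ (Fin n)),
      IsLocallyFiniteMeasure ν → ∫⁻ z, poissonIntegral ν z ^ q ∂σ ≤ M * ν univ ^ q := by
  have key : ∀ (κ : ℝ≥0∞) (ν : Measure (EuclideanSpace ℝ (Fin n))),
      eLpNorm (poissonIntegral ν) (ENNReal.ofReal q) σ ≤ κ * ν univ ↔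
        ∫⁻ z, poissonIntegral ν z ^ q ∂σ ≤ κ ^ q * ν univ ^ q := by
    intro κ ν
    rw [eLpNorm_eq_lintegral_rpow_enorm_toReal (by simpa using hq0) ENNReal.ofReal_ne_top,
      ENNReal.toReal_ofReal hq0.le, one_div, ENNReal.rpow_inv_le_iff hq0,
      ENNReal.mul_rpow_of_nonneg _ _ hq0.le]
    simp only [enorm_eq_self]
  constructor
  · rintro ⟨κ, -, h⟩
    exact ⟨ENNReal.ofReal κ ^ q, ENNReal.rpow_ne_top_of_nonneg hq0.le ENNReal.ofReal_ne_top,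
      fun ν hν => (key _ ν).1 (h ν hν)⟩
  · rintro ⟨M, hM, h⟩
    refine ⟨(M ^ q⁻¹).toReal + 1, by positivity, fun ν hν => (key _ ν).2 ((h ν hν).trans ?_)⟩
    gcongr
    rw [← ENNReal.rpow_inv_le_iff hq0]
    refine ENNReal.le_ofReal_iff_toReal_le
      (ENNReal.rpow_ne_top_of_nonneg (by positivity) hM) (by positivity) |>.2 (by linarith)

/-- On a finite measure space weak `L¹` functions are in `L^q` for `0 < q < 1`. -/
lemma exists_lintegral_rpow_le_of_weak {α : Type*} [MeasurableSpace α] (ω : Measure α)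
    (hω : ω univ ≠ ∞) {q : ℝ} (hq0 : 0 < q) (hq1 : q < 1) {K : ℝ≥0∞} (hK : K ≠ ∞) :
    ∃ M : ℝ≥0∞, M ≠ ∞ ∧ ∀ g : α → ℝ, Measurable g → (∀ a, 0 ≤ g a) →
      (∀ t : ℝ, 0 < t → ω {a | t < g a} ≤ K * ENNReal.ofReal t⁻¹) →
        ∫⁻ a, ENNReal.ofReal (g a ^ q) ∂ω ≤ M := by
  -- In the layer-cake formula the total mass bounds the levels below 1, where `q > 0` gives
  -- convergence, and the weak bound those above 1, where `q < 1` does.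
  have h1 : ∫⁻ t in Ioo (0 : ℝ) 1, ENNReal.ofReal (t ^ (q - 1)) < ∞ :=
    ((intervalIntegral.integrableOn_Ioo_rpow_iff one_pos).2 (by linarith)).lintegral_lt_top
  have h2 : ∫⁻ t in Ioi (1 : ℝ), ENNReal.ofReal (t ^ (q - 2)) < ∞ :=
    (integrableOn_Ioi_rpow_of_lt (by linarith) one_pos).lintegral_lt_top
  refine ⟨ENNReal.ofReal q * (ω univ * (∫⁻ t in Ioo (0 : ℝ) 1, ENNReal.ofReal (t ^ (q - 1))) +
    K * ∫⁻ t in Ioi (1 : ℝ), ENNReal.ofReal (t ^ (q - 2))), by finiteness, fun g hg hg0 h => ?_⟩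
  rw [lintegral_rpow_eq_lintegral_meas_lt_mul ω (Eventually.of_forall hg0) hg.aemeasurable hq0]
  gcongr
  rw [← Ioc_union_Ioi_eq_Ioi zero_le_one]
  refine (lintegral_union_le _ _ _).trans ?_
  rw [setLIntegral_congr Ioo_ae_eq_Ioc.symm]
  gcongr
  · rw [← lintegral_const_mul' _ _ hω]
    exact lintegral_mono fun t => by gcongr; exact subset_univ _
  · rw [← lintegral_const_mul' _ _ hK]
    refine setLIntegral_mono' measurableSet_Ioi fun t ht => ?_
    have ht0 : (0 : ℝ) < t := one_pos.trans ht
    refine (mul_le_mul_left (h t ht0) _).trans (le_of_eq ?_)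
    rw [mul_assoc, ← ENNReal.ofReal_mul (by positivity), ← Real.rpow_neg_one,
      ← Real.rpow_add ht0]
    congr 3
    ring

/-- A point `w` of the ball has height at most `2r` and projection within `r` of `z.1`, so its
kernel puts mass at least `c` on the tripled boundary ball. Tonelli turns this into a bound by the
integral of `P*ω`. -/
lemma exists_mul_measure_closedBall_le (n : ℕ) :
    ∃ c : ℝ≥0∞, c ≠ 0 ∧ c ≠ ∞ ∧ ∀ (ω : Measure (UpperHalfSpace n)) (_ : SFinite ω)
      (φ : EuclideanSpace ℝ (Fin n) → ℝ≥0∞), (∀ᵐ t, poissonBalayage ω t ≤ φ t) →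
      c * ω univ ≤ ∫⁻ t, φ t ∧
      ∀ (z : UpperHalfSpace n) (r : ℝ), (z.2 : ℝ) ≤ r →
        c * ω (closedBall z r) ≤ volume.withDensity φ (ball z.1 (3 * r)) := by
  obtain ⟨c, hc0, hc, h⟩ := exists_le_lintegral_ball_poissonKernelHS n
  refine ⟨c, hc0, hc, fun ω _ φ hφ => ⟨?_, fun z r hr => ?_⟩⟩
  · calc c * ω univ = ∫⁻ _, c ∂ω := by simp
      _ ≤ ∫⁻ z, (∫⁻ t in univ, ENNReal.ofReal (poissonKernelHS n (z.1 - t) z.2)) ∂ω :=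
          lintegral_mono fun z => (h z).trans (lintegral_mono_set (subset_univ _))
      _ = ∫⁻ t, poissonBalayage ω t := by rw [← lintegral_poissonBalayage, setLIntegral_univ]
      _ ≤ _ := lintegral_mono_ae hφ
  · rw [withDensity_apply _ measurableSet_ball]
    calc c * ω (closedBall z r) = ∫⁻ _ in closedBall z r, c ∂ω := by simp
      _ ≤ ∫⁻ w in closedBall z r,
            (∫⁻ t in ball z.1 (3 * r), ENNReal.ofReal (poissonKernelHS n (w.1 - t) w.2)) ∂ω := by
          refine setLIntegral_mono' isClosed_closedBall.measurableSet fun w hw => ?_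
          refine (h w).trans (lintegral_mono_set (ball_subset_ball' ?_))
          rw [mem_closedBall, Prod.dist_eq, max_le_iff, Subtype.dist_eq, Real.dist_eq] at hw
          have := (abs_le.1 hw.2).2
          linarith [hw.1]
      _ ≤ ∫⁻ w, (∫⁻ t in ball z.1 (3 * r),
            ENNReal.ofReal (poissonKernelHS n (w.1 - t) w.2)) ∂ω := setLIntegral_le_lintegral _ _
      _ = ∫⁻ t in ball z.1 (3 * r), poissonBalayage ω t := (lintegral_poissonBalayage ω _).symm
      _ ≤ _ := lintegral_mono_ae (ae_restrict_of_ae hφ)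

/-- The weak-type `(1,1)` bound for the ratio of two Poisson integrals. -/
lemma exists_measure_mul_lt_poissonIntegral_le (n : ℕ) :
    ∃ C : ℝ≥0∞, C ≠ ∞ ∧ ∀ (ω : Measure (UpperHalfSpace n)) (_ : SFinite ω)
      (φ : EuclideanSpace ℝ (Fin n) → ℝ≥0∞), (∀ᵐ t, poissonBalayage ω t ≤ φ t) →
      ∀ (ν : Measure (EuclideanSpace ℝ (Fin n))) (t : ℝ), 0 < t →
        ω {z | ENNReal.ofReal t * poissonIntegralFun φ z < poissonIntegral ν z} ≤
          C * ν univ * ENNReal.ofReal t⁻¹ := by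
  obtain ⟨c, hc0, hc, hball⟩ := exists_mul_measure_closedBall_le n
  obtain ⟨C, hC0, hC, hcomp⟩ := exists_poissonIntegral_le_of_ball_le n
  obtain ⟨N, hN⟩ := exists_measure_le_of_closedBall_le n
  refine ⟨N * (c⁻¹ * C), by finiteness, fun ω hω φ hφ ν t ht => ?_⟩
  have ht0 : ENNReal.ofReal t ≠ 0 := by simpa using ht
  refine (hN ω ν (c⁻¹ * C * ENNReal.ofReal t⁻¹) _ fun z hz => ?_).trans (le_of_eq (by ring))
  -- If no radius is admissible, `ν` is dominated on all balls of radius at least the height by `C⁻¹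
  -- t` times `φ dt` on tripled balls, so `Pν(z) ≤ t Pφ(z)`.
  by_contra! hcon
  refine not_le.2 hz ((hcomp ν (volume.withDensity φ) (C⁻¹ * ENNReal.ofReal t) z
    fun r hr => ?_).trans (le_of_eq ?_))
  · have h1 := (hcon r hr).le
    have h2 := (hball ω hω φ hφ).2 z r hr
    rw [ENNReal.ofReal_inv_of_pos ht] at h1
    calc ν (ball z.1 r)
        = c * (C⁻¹ * ENNReal.ofReal t) *
            (c⁻¹ * C * (ENNReal.ofReal t)⁻¹ * ν (ball z.1 r)) := by
          calc _ = (c * c⁻¹) * (C⁻¹ * C) * (ENNReal.ofReal t * (ENNReal.ofReal t)⁻¹) *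
                ν (ball z.1 r) := by
                rw [ENNReal.mul_inv_cancel hc0 hc, ENNReal.inv_mul_cancel hC0 hC,
                  ENNReal.mul_inv_cancel ht0 ENNReal.ofReal_ne_top]
                simp
            _ = _ := by ring
      _ ≤ c * (C⁻¹ * ENNReal.ofReal t) * ω (closedBall z r) := by gcongr
      _ = C⁻¹ * ENNReal.ofReal t * (c * ω (closedBall z r)) := by ring
      _ ≤ _ := by gcongr
  · rw [← mul_assoc, ENNReal.mul_inv_cancel hC0 hC, one_mul]
    rfl

lemma poissonCarleson_of_supersolution {q : ℝ} (hq0 : 0 < q) (hq1 : q < 1)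
    (σ : Measure (UpperHalfSpace n)) [SFinite σ] (φ : EuclideanSpace ℝ (Fin n) → ℝ≥0∞)
    (hφi : Integrable φ volume) (hφ0 : ∀ᵐ t, 0 < φ t)
    (hφ : ∀ᵐ t, poissonNonlinear q σ φ t ≤ φ t) : PoissonCarleson q σ := by
  have hφfin : ∫⁻ t, φ t < ∞ := by simpa [HasFiniteIntegral] using hφi.2
  have hfm : IsFiniteMeasure (volume.withDensity φ) := isFiniteMeasure_withDensity hφfin.ne
  have hne : volume.withDensity φ ≠ 0 := by
    rw [Ne, withDensity_eq_zero_iff hφi.1.aemeasurable]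
    intro h
    obtain ⟨t, ht, ht'⟩ := (h.and hφ0).exists
    exact ht'.ne' ht
  set u := poissonIntegralFun φ with hu
  have hu0 : ∀ z, u z ≠ 0 := fun z => (poissonIntegral_pos hne z).ne'
  have hut : ∀ z, u z ≠ ∞ := fun z => (poissonIntegral_lt_top _ z).ne
  have hum : Measurable u := measurable_poissonIntegralFun φ
  set ω := σ.withDensity fun z => u z ^ q with hω
  obtain ⟨c, hc0, hc, hball⟩ := exists_mul_measure_closedBall_le n
  have hωfin : ω univ ≠ ∞ := by
    have := (hball ω inferInstance φ hφ).1.trans_lt hφfin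
    exact fun h => this.ne (by rw [h, ENNReal.mul_top hc0])
  obtain ⟨C, hC, hweak⟩ := exists_measure_mul_lt_poissonIntegral_le n
  obtain ⟨M, hM, hstrong⟩ := exists_lintegral_rpow_le_of_weak ω hωfin hq0 hq1 hC
  have hprob : ∀ ν : Measure (EuclideanSpace ℝ (Fin n)), IsProbabilityMeasure ν →
      ∫⁻ z, poissonIntegral ν z ^ q ∂σ ≤ M := by
    intro ν hν
    have hνt : ∀ z, poissonIntegral ν z / u z ≠ ∞ := fun z =>
      ENNReal.div_ne_top (poissonIntegral_lt_top ν z).ne (hu0 z)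
    have hm : Measurable fun z => poissonIntegral ν z / u z :=
      (measurable_poissonIntegral ν).div hum
    refine le_trans (le_of_eq ?_) (hstrong (fun z => (poissonIntegral ν z / u z).toReal)
      hm.ennreal_toReal (fun z => ENNReal.toReal_nonneg) fun t ht => ?_)
    · rw [hω, lintegral_withDensity_eq_lintegral_mul _ (hum.pow_const q)
        (hm.ennreal_toReal.pow_const q).ennreal_ofReal]
      refine lintegral_congr fun z => ?_
      rw [Pi.mul_apply, ← ENNReal.ofReal_rpow_of_nonneg ENNReal.toReal_nonneg hq0.le,
        ENNReal.ofReal_toReal (hνt z), ← ENNReal.mul_rpow_of_nonneg _ _ hq0.le,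
        ENNReal.mul_div_cancel (hu0 z) (hut z)]
    · refine (measure_mono fun z hz => ?_).trans
        ((hweak ω inferInstance φ hφ ν t ht).trans (by simp))
      have hz' := (ENNReal.ofReal_lt_iff_lt_toReal ht.le (hνt z)).2 hz
      exact (ENNReal.lt_div_iff_mul_lt (Or.inl (hu0 z)) (Or.inl (hut z))).1 hz'
  -- The added 1 keeps the constant nonzero, so that the right side is infinite when `ν` has
  -- infinite mass.
  refine (poissonCarleson_iff hq0 σ).2 ⟨M + 1, by finiteness, fun ν _ => ?_⟩
  rcases eq_or_ne (ν univ) ∞ with htop | htop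
  · rw [htop, ENNReal.top_rpow_of_pos hq0, ENNReal.mul_top (by simp)]
    exact le_top
  rcases eq_or_ne (ν univ) 0 with h0 | h0
  · rw [Measure.measure_univ_eq_zero] at h0
    simp [h0, poissonIntegral, hq0]
  have hν : poissonIntegral ν = fun z => ν univ * poissonIntegral ((ν univ)⁻¹ • ν) z := by
    ext z
    simp only [poissonIntegral]
    rw [lintegral_smul_measure, smul_eq_mul, ← mul_assoc, ENNReal.mul_inv_cancel h0 htop, one_mul]
  rw [hν]
  simp_rw [ENNReal.mul_rpow_of_nonneg _ _ hq0.le]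
  rw [lintegral_const_mul' _ _ (ENNReal.rpow_ne_top_of_nonneg hq0.le htop), mul_comm]
  gcongr
  refine (hprob _ ⟨?_⟩).trans le_self_add
  rw [Measure.smul_apply, smul_eq_mul, ENNReal.inv_mul_cancel h0 htop]

end Sufficiency

/-! ### From the Carleson inequality to a fixed point. -/

section Necessity

variable {n : ℕ}

lemma poissonIntegralFun_mono : Monotone (poissonIntegralFun (n := n)) := fun _ _ h _ =>
  lintegral_mono' (withDensity_mono (Eventually.of_forall h)) le_rfl

lemma poissonNonlinear_mono {q : ℝ} (hq0 : 0 < q) (σ : Measure (UpperHalfSpace n)) :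
    Monotone (poissonNonlinear q σ) := fun _ _ h _ =>
  lintegral_mono' (withDensity_mono (Eventually.of_forall fun z =>
    ENNReal.rpow_le_rpow (poissonIntegralFun_mono h z) hq0.le)) le_rfl

lemma poissonIntegralFun_iSup {φ : ℕ → EuclideanSpace ℝ (Fin n) → ℝ≥0∞}
    (hφ : ∀ j, Measurable (φ j)) (hmono : Monotone φ) (z : UpperHalfSpace n) :
    poissonIntegralFun (fun t => ⨆ j, φ j t) z = ⨆ j, poissonIntegralFun (φ j) z := by
  simp_rw [poissonIntegralFun_eq (hφ _).aemeasurable,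
    poissonIntegralFun_eq (Measurable.iSup hφ).aemeasurable, ENNReal.iSup_mul]
  exact lintegral_iSup (fun j => (hφ j).mul (measurable_poissonKernelHS_right z))
    fun i j hij t => mul_le_mul_left (hmono hij t) _

lemma poissonNonlinear_iSup {q : ℝ} (hq0 : 0 < q) (σ : Measure (UpperHalfSpace n))
    {φ : ℕ → EuclideanSpace ℝ (Fin n) → ℝ≥0∞} (hφ : ∀ j, Measurable (φ j)) (hmono : Monotone φ)
    (t : EuclideanSpace ℝ (Fin n)) :
    poissonNonlinear q σ (fun t => ⨆ j, φ j t) t = ⨆ j, poissonNonlinear q σ (φ j) t := by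
  have hpow : ∀ a : ℕ → ℝ≥0∞, (⨆ j, a j) ^ q = ⨆ j, a j ^ q := fun a =>
    (ENNReal.orderIsoRpow q hq0).map_iSup a
  simp_rw [poissonNonlinear_eq, poissonIntegralFun_iSup hφ hmono, hpow, ENNReal.iSup_mul]
  exact lintegral_iSup (fun j => ((measurable_poissonIntegralFun _).pow_const q).mul
    (measurable_poissonKernelHS_left t)) fun i j hij z =>
      mul_le_mul_left (ENNReal.rpow_le_rpow (poissonIntegralFun_mono (hmono hij) z) hq0.le) _

/-- Turns the Carleson inequality into an `L¹` bound for the iteration. -/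
lemma lintegral_poissonNonlinear (q : ℝ) (σ : Measure (UpperHalfSpace n)) [SFinite σ]
    (φ : EuclideanSpace ℝ (Fin n) → ℝ≥0∞) :
    ∫⁻ t, poissonNonlinear q σ φ t =
      (∫⁻ s : EuclideanSpace ℝ (Fin n), ENNReal.ofReal (poissonKernelHS n s 1)) *
        ∫⁻ z, poissonIntegralFun φ z ^ q ∂σ := by
  unfold poissonNonlinear
  rw [← setLIntegral_univ, lintegral_poissonBalayage]
  simp only [setLIntegral_univ, lintegral_poissonKernelHS_eq]
  rw [lintegral_const, withDensity_apply _ MeasurableSet.univ, setLIntegral_univ]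

instance UpperHalfSpace.locallyCompactSpace (n : ℕ) : LocallyCompactSpace (UpperHalfSpace n) :=
  have : LocallyCompactSpace (Ioi (0 : ℝ)) := isOpen_Ioi.locallyCompactSpace
  inferInstance

/-- A small multiple of the indicator of a ball is a subsolution. -/
lemma exists_indicator_le_poissonNonlinear {q : ℝ} (hq0 : 0 < q) (hq1 : q < 1)
    (σ : Measure (UpperHalfSpace n)) [IsLocallyFiniteMeasure σ] (hσ : σ ≠ 0) :
    ∃ ε : ℝ≥0∞, ε ≠ 0 ∧ ε ≠ ∞ ∧
      (ball (0 : EuclideanSpace ℝ (Fin n)) 1).indicator (fun _ => ε) ≤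
        poissonNonlinear q σ ((ball (0 : EuclideanSpace ℝ (Fin n)) 1).indicator fun _ => ε) := by
  obtain ⟨K, -, hK, hσK⟩ := isOpen_univ.exists_lt_isCompact (Measure.measure_univ_pos.2 hσ)
  have hKne : K.Nonempty := nonempty_of_measure_ne_zero hσK.ne'
  obtain ⟨⟨w, s⟩, -, hmin⟩ :=
    (hK.prod (isCompact_closedBall (0 : EuclideanSpace ℝ (Fin n)) 1)).exists_isMinOn
    (hKne.prod (nonempty_closedBall.2 zero_le_one)) continuous_poissonKernelHS.continuousOn
  have hc0 := poissonKernelHS_pos (w.1 - s) w.2.2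
  set c := ENNReal.ofReal (poissonKernelHS n (w.1 - s) w.2) with hc
  have hcne : c ≠ 0 := by simpa [hc] using hc0
  have hct : c ≠ ∞ := ENNReal.ofReal_ne_top
  have hlow : ∀ z ∈ K, ∀ t ∈ ball (0 : EuclideanSpace ℝ (Fin n)) 1,
      c ≤ ENNReal.ofReal (poissonKernelHS n (z.1 - t) z.2) := fun z hz t ht =>
    ENNReal.ofReal_le_ofReal (hmin (show (z, t) ∈ K ×ˢ closedBall 0 1 from
      ⟨hz, ball_subset_closedBall ht⟩))
  set V := volume (ball (0 : EuclideanSpace ℝ (Fin n)) 1) with hV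
  have hV0 : V ≠ 0 := (measure_ball_pos _ _ one_pos).ne'
  have hVt : V ≠ ∞ := measure_ball_lt_top.ne
  have hσKt : σ K ≠ ∞ := hK.measure_lt_top.ne
  have hdt : (c * V) ^ q ≠ ∞ := ENNReal.rpow_ne_top_of_nonneg hq0.le (by finiteness)
  have hd0 : (c * V) ^ q ≠ 0 := by
    simp [ENNReal.rpow_eq_zero_iff, hcne, hV0, hq0, hq0.not_gt]
  set D := (c * V) ^ q * (c * σ K) with hD
  have hD0 : D ≠ 0 := mul_ne_zero hd0 (mul_ne_zero hcne hσK.ne')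
  have hDt : D ≠ ∞ := by finiteness
  have hq1' : 0 < 1 - q := by linarith
  -- On the unit ball the nonlinear operator sends `ε` times the indicator to at least `ε ^ q * D`;
  -- this `ε` solves `ε ^ q * D = ε`.
  set ε := D ^ (1 - q)⁻¹ with hε
  have hε0 : ε ≠ 0 := by
    simp [hε, ENNReal.rpow_eq_zero_iff, hD0, hDt]
  have hεt : ε ≠ ∞ := ENNReal.rpow_ne_top_of_nonneg (by positivity) hDt
  refine ⟨ε, hε0, hεt, fun t => ?_⟩
  by_cases ht : t ∈ ball (0 : EuclideanSpace ℝ (Fin n)) 1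
  swap
  · rw [indicator_of_notMem ht]; exact zero_le
  rw [indicator_of_mem ht]
  have hu : ∀ z ∈ K, ε * (c * V) ≤ poissonIntegralFun
      ((ball (0 : EuclideanSpace ℝ (Fin n)) 1).indicator fun _ => ε) z := by
    intro z hz
    rw [poissonIntegralFun_eq (measurable_const.indicator measurableSet_ball).aemeasurable]
    calc ε * (c * V) = ∫⁻ _ in ball (0 : EuclideanSpace ℝ (Fin n)) 1, ε * c := by
          rw [setLIntegral_const, mul_assoc]
      _ ≤ ∫⁻ t in ball (0 : EuclideanSpace ℝ (Fin n)) 1,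
          (ball (0 : EuclideanSpace ℝ (Fin n)) 1).indicator (fun _ => ε) t *
            ENNReal.ofReal (poissonKernelHS n (z.1 - t) z.2) := by
          refine setLIntegral_mono' measurableSet_ball fun s hs => ?_
          rw [indicator_of_mem hs]
          gcongr
          exact hlow z hz s hs
      _ ≤ _ := setLIntegral_le_lintegral _ _
  rw [poissonNonlinear_eq]
  calc ε = ε ^ q * D := by
        have : D = ε ^ (1 - q) := by rw [hε, ENNReal.rpow_inv_rpow hq1'.ne']
        rw [this, ← ENNReal.rpow_add _ _ hε0 hεt]
        simp
    _ = ∫⁻ _ in K, (ε * (c * V)) ^ q * c ∂σ := by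
        rw [setLIntegral_const, hD, ENNReal.mul_rpow_of_nonneg ε _ hq0.le]
        ring
    _ ≤ ∫⁻ z in K, poissonIntegralFun
          ((ball (0 : EuclideanSpace ℝ (Fin n)) 1).indicator fun _ => ε) z ^ q *
            ENNReal.ofReal (poissonKernelHS n (z.1 - t) z.2) ∂σ := by
        refine setLIntegral_mono' hK.measurableSet fun z hz => ?_
        gcongr
        · exact hu z hz
        · exact hlow z hz t ht
    _ ≤ _ := setLIntegral_le_lintegral _ _

lemma exists_solution_of_poissonCarleson {q : ℝ} (hq0 : 0 < q) (hq1 : q < 1)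
    (σ : Measure (UpperHalfSpace n)) [IsLocallyFiniteMeasure σ] (hσ : σ ≠ 0)
    (h : PoissonCarleson q σ) :
    ∃ φ : EuclideanSpace ℝ (Fin n) → ℝ≥0∞,
      Integrable φ volume ∧ (∀ t, 0 < φ t) ∧ ∀ t, φ t = poissonNonlinear q σ φ t := by
  obtain ⟨M, hM, hineq⟩ := (poissonCarleson_iff hq0 σ).1 h
  obtain ⟨ε, hε0, hεt, hsub⟩ := exists_indicator_le_poissonNonlinear hq0 hq1 σ hσ
  set φ₀ := (ball (0 : EuclideanSpace ℝ (Fin n)) 1).indicator fun _ => ε with hφ₀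
  have hφ₀m : Measurable φ₀ := measurable_const.indicator measurableSet_ball
  have hφ₀i : ∫⁻ t, φ₀ t ≠ ∞ := by
    rw [hφ₀, lintegral_indicator measurableSet_ball, setLIntegral_const]
    exact ENNReal.mul_ne_top hεt measure_ball_lt_top.ne
  set φ : ℕ → EuclideanSpace ℝ (Fin n) → ℝ≥0∞ :=
    fun j => (poissonNonlinear q σ)^[j] φ₀ with hφ
  have hsucc : ∀ j, φ (j + 1) = poissonNonlinear q σ (φ j) := fun j =>
    Function.iterate_succ_apply' _ _ _
  have hmono : Monotone φ := (poissonNonlinear_mono hq0 σ).monotone_iterate_of_le_map hsub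
  have hmeas : ∀ j, Measurable (φ j) := by
    rintro (_ | j)
    · exact hφ₀m
    · rw [hsucc]
      exact measurable_poissonNonlinear q σ _
  set A := (∫⁻ s : EuclideanSpace ℝ (Fin n), ENNReal.ofReal (poissonKernelHS n s 1)) * M with hA
  have hAt : A ≠ ∞ := ENNReal.mul_ne_top lintegral_poissonKernelHS_one_lt_top.ne hM
  have hq1' : 0 < 1 - q := by linarith
  -- `L` bounds the initial mass and is large enough that `A * L ^ q ≤ L`, so the bound survives
  -- each iteration.
  set L := max (∫⁻ t, φ₀ t) (A ^ (1 - q)⁻¹) with hL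
  have hLt : L ≠ ∞ :=
    (max_lt hφ₀i.lt_top (ENNReal.rpow_lt_top_of_nonneg (by positivity) hAt)).ne
  have hAL : A * L ^ q ≤ L := by
    calc A * L ^ q ≤ L ^ (1 - q) * L ^ q := by
          gcongr
          rw [← ENNReal.rpow_inv_le_iff hq1']
          exact le_max_right _ _
      _ = L := by
          rw [← ENNReal.rpow_add_of_nonneg _ _ hq1'.le hq0.le]
          simp
  have hbound : ∀ j, ∫⁻ t, φ j t ≤ L := by
    intro j
    induction j with
    | zero => exact le_max_left _ _
    | succ j ih =>
      have hfin : IsFiniteMeasure (volume.withDensity (φ j)) :=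
        isFiniteMeasure_withDensity (ih.trans_lt hLt.lt_top).ne
      rw [hsucc, lintegral_poissonNonlinear]
      refine le_trans ?_ hAL
      rw [hA, mul_assoc]
      gcongr
      refine (hineq (volume.withDensity (φ j)) inferInstance).trans ?_
      rw [withDensity_apply _ MeasurableSet.univ, setLIntegral_univ]
      gcongr
  have hfix : ∀ t, (⨆ j, φ j t) = poissonNonlinear q σ (fun t => ⨆ j, φ j t) t := by
    intro t
    rw [poissonNonlinear_iSup hq0 σ hmeas hmono]
    simp_rw [← hsucc]
    exact (Monotone.iSup_nat_add (f := fun j => φ j t) (fun i j hij => hmono hij t) 1).symm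
  refine ⟨fun t => ⨆ j, φ j t, ⟨(Measurable.iSup hmeas).aestronglyMeasurable, ?_⟩,
    fun t => ?_, hfix⟩
  · simp only [HasFiniteIntegral, enorm_eq_self]
    rw [lintegral_iSup hmeas hmono]
    exact (iSup_le hbound).trans_lt hLt.lt_top
  · refine lt_of_lt_of_eq ?_ (hfix t).symm
    -- Positivity at every point comes from the equation: the limit dominates `φ₀`, so its Poisson
    -- integral is positive everywhere, and the balayage of a nonzero measure is positive
    -- everywhere.
    refine poissonBalayage_pos (fun h0 => ?_) t
    rw [withDensity_eq_zero_iff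
      ((measurable_poissonIntegralFun _).pow_const q).aemeasurable] at h0
    have : ∃ᵐ _ ∂σ, True := by
      rw [frequently_true_iff_neBot]
      exact ae_neBot.2 hσ
    obtain ⟨z, -, hz⟩ := (this.and_eventually h0).exists
    rw [Pi.zero_apply, ENNReal.rpow_eq_zero_iff_of_pos hq0] at hz
    refine (poissonIntegral_pos (fun hν => ?_) z).ne' hz
    have h1 := measure_mono_null (subset_univ (ball (0 : EuclideanSpace ℝ (Fin n)) 1))
      (Measure.measure_univ_eq_zero.2 hν)
    rw [withDensity_apply _ measurableSet_ball] at h1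
    have h2 : ∫⁻ _ in ball (0 : EuclideanSpace ℝ (Fin n)) 1, ε ≤ 0 := by
      rw [← h1]
      refine setLIntegral_mono' measurableSet_ball fun t ht => ?_
      refine le_trans (le_of_eq ?_) (le_iSup (fun j => φ j t) 0)
      exact (indicator_of_mem ht fun _ => ε).symm
    rw [setLIntegral_const, nonpos_iff_eq_zero, mul_eq_zero] at h2
    exact h2.elim hε0 (measure_ball_pos volume (0 : EuclideanSpace ℝ (Fin n)) one_pos).ne'

lemma integrable_ofReal_poissonKernelHS_one (n : ℕ) :
    Integrable (fun t : EuclideanSpace ℝ (Fin n) => ENNReal.ofReal (poissonKernelHS n t 1))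
      volume := by
  refine ⟨?_, by simpa [HasFiniteIntegral] using lintegral_poissonKernelHS_one_lt_top⟩
  have := (measurable_poissonKernelHS_right
    (((0 : EuclideanSpace ℝ (Fin n)), ⟨1, mem_Ioi.2 one_pos⟩) : UpperHalfSpace n)).comp measurable_neg
  simpa [Function.comp_def] using this.aestronglyMeasurable (μ := volume)

end Necessity

theorem corollary4p2 (n : ℕ) (hn : 1 ≤ n) (q : ℝ) (hq0 : 0 < q) (hq1 : q < 1)
    (σ : Measure (UpperHalfSpace n)) [IsLocallyFiniteMeasure σ] :
    (PoissonCarleson q σ ↔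
      ∃ φ : EuclideanSpace ℝ (Fin n) → ℝ≥0∞,
        Integrable φ volume ∧ (∀ᵐ t, 0 < φ t) ∧ ∀ᵐ t, poissonNonlinear q σ φ t ≤ φ t) ∧
    (σ ≠ 0 → PoissonCarleson q σ →
      ∃ φ : EuclideanSpace ℝ (Fin n) → ℝ≥0∞,
        Integrable φ volume ∧ (∀ t, 0 < φ t) ∧ ∀ t, φ t = poissonNonlinear q σ φ t) := by
  refine ⟨⟨fun h => ?_, fun ⟨φ, hi, h0, hφ⟩ =>
    poissonCarleson_of_supersolution hq0 hq1 σ φ hi h0 hφ⟩,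
    fun hσ h => exists_solution_of_poissonCarleson hq0 hq1 σ hσ h⟩
  -- For `σ = 0` the only fixed point is zero, but any positive integrable function is a
  -- supersolution; the kernel at height 1 serves.
  rcases eq_or_ne σ 0 with rfl | hσ
  · refine ⟨fun t => ENNReal.ofReal (poissonKernelHS n t 1),
      integrable_ofReal_poissonKernelHS_one n, Eventually.of_forall fun t => ?_,
      Eventually.of_forall fun t => ?_⟩
    · simpa using poissonKernelHS_pos t one_pos
    · simp [poissonNonlinear_eq]
  · obtain ⟨φ, hi, h0, hφ⟩ := exists_solution_of_poissonCarleson hq0 hq1 σ hσ h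
    exact ⟨φ, hi, Eventually.of_forall h0, Eventually.of_forall fun t => (hφ t).ge⟩
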